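/- Let $X$ be a Banach space over $\mathbb K=\mathbb R$ or $\mathbb C$, and let $\ell_2$ be the Hilbert space of square-summable sequences in $\mathbb K$. For a Banach space $Y$ let $\Pi_2(X,Y)$ be the set of $2$-summing operators, that is, of those bounded linear operators $T\colon X\to Y$ such that $\sum_{n}\|Tx_n\|^2<\infty$ for every sequence $(x_n)$ in $X$ with $\sum_n|f(x_n)|^2<\infty$ for all $f\in X^*$. Let $N(X,Y)$ be the set of nuclear operators, that is, of those bounded linear operators $T\colon X\to Y$ for which there are $(\lambda_n)\in\ell_1$, a bounded sequence $(f_n)$ in $X^*$ and a bounded sequence $(y_n)$ in $Y$ such that $Tx=\sum_{n=1}^\infty\lambda_n f_n(x)\,y_n$ for all $x\in X$. Then the following are equivalent: (i) $\Pi_2(X,\ell_2)=N(X,\ell_2)$; (ii) $X$ is finite dimensional. -/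

import Mathlib

/-- `ℓ_p[X]`: the weakly `p`-summable sequences in `X`, that is, the sequences `(x n)` with
`∑ |f (x n)| ^ p < ∞` for every continuous linear functional `f` on `X`. -/
def weaklySummableSeq (𝕜 : Type*) [RCLike 𝕜] (p : ℝ) (X : Type*) [NormedAddCommGroup X]
    [NormedSpace 𝕜 X] : Set (ℕ → X) :=
  {x | ∀ f : StrongDual 𝕜 X, Summable fun n => ‖f (x n)‖ ^ p}

/-- `ℓ_p{X}`: the (strongly) `p`-summable sequences in `X`, that is, the sequences `(x n)` with
`∑ ‖x n‖ ^ p < ∞`. -/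
def stronglySummableSeq (p : ℝ) (X : Type*) [NormedAddCommGroup X] : Set (ℕ → X) :=
  {x | Summable fun n => ‖x n‖ ^ p}

/-- `Π_p(X, Y)`: the (absolutely) `p`-summing operators, that is, the bounded linear operators
that map every weakly `p`-summable sequence to a strongly `p`-summable one (for `1 ≤ p`). -/
def summingOperators (𝕜 : Type*) [RCLike 𝕜] (p : ℝ) (X Y : Type*)
    [NormedAddCommGroup X] [NormedSpace 𝕜 X] [NormedAddCommGroup Y] [NormedSpace 𝕜 Y] :
    Set (X →L[𝕜] Y) :=
  {T | ∀ x ∈ weaklySummableSeq 𝕜 p X, (fun n => T (x n)) ∈ stronglySummableSeq p Y}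

/-- `N(X, Y)`: the nuclear operators, that is, the bounded linear operators of the form
`T x = ∑ c n • f n x • y n` with `(c n)` an absolutely summable sequence of scalars,
`(f n)` a bounded sequence in the dual of `X`, and `(y n)` a bounded sequence in `Y`. -/
def nuclearOperators (𝕜 : Type*) [RCLike 𝕜] (X Y : Type*)
    [NormedAddCommGroup X] [NormedSpace 𝕜 X] [NormedAddCommGroup Y] [NormedSpace 𝕜 Y] :
    Set (X →L[𝕜] Y) :=
  {T | ∃ (c : ℕ → 𝕜) (f : ℕ → StrongDual 𝕜 X) (y : ℕ → Y),
    (Summable fun n => ‖c n‖) ∧ (∃ A : ℝ, ∀ n, ‖f n‖ ≤ A) ∧ (∃ B : ℝ, ∀ n, ‖y n‖ ≤ B) ∧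
      ∀ x : X, HasSum (fun n => c n • f n x • y n) (T x)}

/-!
If `X` is finite dimensional, expanding along a basis shows that every operator on `X` is both
`2`-summing and nuclear.

For the converse, the point is that a `2`-summing operator can be bounded below on subspaces `E` of
large dimension with a constant of order only `√(dim E)`, which nuclearity forbids.

* *Existence.* On an `n`-dimensional subspace `E` there are functionals `f j` in the unit ball and
  weights `w j ≥ 0` of total mass `1` with `‖x‖ ^ 2 ≤ 2 n ∑ w j |f j x| ^ 2` for `x ∈ E`
  (`exists_weights_norm_sq_le`). This is a Kiefer–Wolfowitz (`D`-optimal design) argument: among the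
  Gram matrices `∑ w j (f j)* (f j)` take one with nearly maximal determinant; if the inequality
  failed at some functional, moving a little mass to it would increase the determinant
  (`exists_weights_norm_dotProduct_sq_le`). The operator `x ↦ (√(w j) f j x)` into `ℓ₂` is then
  `2`-summing (`mem_summingOperators_of_hasSum`).
* *Gluing.* If `X` is infinite dimensional, choose subspaces `E k` of dimension `16 ^ k`, and put
  the operators for them together with weights `4 ^ (-k)`. The result is a single `2`-summing `T`
  with `‖x‖ ≤ 2 * 8 ^ k * ‖T x‖` on `E k` (`exists_mem_summingOperators_norm_le`).
* *Trace.* If `T = ∑ c n • f n ⊗ y n` is nuclear and `‖x‖ ≤ A ‖T x‖` on `E`, then `T` has on `E` a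
  left inverse `R` of norm at most `A` defined on the whole Hilbert space, and computing the trace
  of `id_E = R T` gives `dim E = ∑ c n * f n (R (y n)) ≤ A M`, where `M` depends on `T` only
  (`finrank_le_of_hasSum`). For `E k` this reads `16 ^ k ≤ 2 * 8 ^ k * M`, false for large `k`.
-/

/-! ### Nearly optimal designs -/

/-- The matrix determinant lemma for a rank-one perturbation of a multiple of `G`. -/
theorem det_smul_add_smul_vecMulVec {n : ℕ} {𝕜 : Type*} [RCLike 𝕜]
    {G : Matrix (Fin n) (Fin n) 𝕜} (hG : G.det ≠ 0) (u v : Fin n → 𝕜) {a : 𝕜} (ha : a ≠ 0)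
    (t : 𝕜) :
    (a • G + t • Matrix.vecMulVec u v).det
      = G.det * (a ^ n * (1 + a⁻¹ * t * (v ⬝ᵥ G⁻¹.mulVec u))) := by
  have hfac : a • G + t • Matrix.vecMulVec u v =
      a • (G * (1 + Matrix.replicateCol Unit (G⁻¹.mulVec u) *
        Matrix.replicateRow Unit ((a⁻¹ * t) • v))) := by
    rw [Matrix.mul_add, Matrix.mul_one, smul_add, ← Matrix.vecMulVec_eq, Matrix.mul_vecMulVec,
      Matrix.mulVec_mulVec, Matrix.mul_nonsing_inv _ (isUnit_iff_ne_zero.2 hG), Matrix.one_mulVec,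
      Matrix.vecMulVec_smul, smul_smul, mul_inv_cancel_left₀ ha]
  rw [hfac, Matrix.det_smul, Matrix.det_mul, Matrix.det_one_add_replicateCol_mul_replicateRow,
    smul_dotProduct, Fintype.card_fin, smul_eq_mul]
  ring

/-- The factor by which the determinant grows when the mass `1 / (2 n)` is moved to a vector at which
the quadratic form of the inverse Gram matrix takes a value `q > 2 n`. -/
theorem one_add_le_of_two_mul_lt {n : ℕ} (hn : 0 < n) {q : ℝ} (hq : 2 * (n : ℝ) < q) :
    1 + 1 / (2 * (n : ℝ)) ≤
      (1 - 1 / (2 * (n : ℝ))) ^ n *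
        (1 + (1 - 1 / (2 * (n : ℝ)))⁻¹ * (1 / (2 * (n : ℝ))) * q) := by
  obtain ⟨m, rfl⟩ : ∃ m, n = m + 1 := ⟨n - 1, by omega⟩
  set t : ℝ := 1 / (2 * ((m + 1 : ℕ) : ℝ)) with ht
  have hm : (0 : ℝ) ≤ m := Nat.cast_nonneg m
  have ht0 : 0 < t := by positivity
  have htm : t * (2 * ((m : ℝ) + 1)) = 1 := by rw [ht]; push_cast; field_simp
  have htle : t ≤ 1 / 2 := by nlinarith
  have hb : 1 - m * t ≤ (1 - t) ^ m := by
    have := one_add_mul_le_pow (a := -t) (by linarith) m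
    simpa [sub_eq_add_neg] using this
  have htq : 1 < t * q := by
    push_cast at hq
    nlinarith
  have h1 : (1 - t) ^ (m + 1) * (1 + (1 - t)⁻¹ * t * q) = (1 - t) ^ m * (1 - t + t * q) := by
    have : (1 - t) ≠ 0 := by linarith
    field_simp
    ring
  rw [h1]
  have h2 : m * t = 1 / 2 - t := by linarith
  calc 1 + t ≤ (1 - m * t) * (2 - t) := by rw [h2]; nlinarith
    _ ≤ (1 - t) ^ m * (1 - t + t * q) :=
      mul_le_mul hb (by linarith) (by linarith) (pow_nonneg (by linarith) m)

theorem star_dotProduct_sum_vecMulVec_mulVec {𝕜 ι : Type*} [RCLike 𝕜] [Fintype ι] {n : ℕ}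
    (w : ι → ℝ) (v : ι → Fin n → 𝕜) (x y : Fin n → 𝕜) :
    star x ⬝ᵥ (∑ j, w j • Matrix.vecMulVec (star (v j)) (v j)).mulVec y =
      ∑ j, (w j : 𝕜) * (star (v j ⬝ᵥ x) * (v j ⬝ᵥ y)) := by
  rw [Matrix.sum_mulVec, dotProduct_sum]
  refine Finset.sum_congr rfl fun j _ => ?_
  rw [Matrix.smul_mulVec, dotProduct_smul, Matrix.vecMulVec_mulVec, dotProduct_smul,
    RCLike.real_smul_eq_coe_mul, ← Matrix.star_dotProduct_star]
  simp [mul_comm, dotProduct_comm]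

/-- The weighted Cauchy–Schwarz inequality. -/
theorem norm_sum_mul_star_mul_sq_le {𝕜 ι : Type*} [RCLike 𝕜] [Fintype ι] {w : ι → ℝ}
    (hw : ∀ j, 0 ≤ w j) (a b : ι → 𝕜) :
    ‖∑ j, (w j : 𝕜) * (star (a j) * b j)‖ ^ 2 ≤
      (∑ j, w j * ‖a j‖ ^ 2) * ∑ j, w j * ‖b j‖ ^ 2 := by
  have h1 : ‖∑ j, (w j : 𝕜) * (star (a j) * b j)‖ ≤
      ∑ j, (Real.sqrt (w j) * ‖a j‖) * (Real.sqrt (w j) * ‖b j‖) := by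
    refine (norm_sum_le _ _).trans (Finset.sum_le_sum fun j _ => le_of_eq ?_)
    rw [norm_mul, norm_mul, norm_star, RCLike.norm_ofReal, abs_of_nonneg (hw j)]
    rw [mul_mul_mul_comm, Real.mul_self_sqrt (hw j)]
  refine (pow_le_pow_left₀ (norm_nonneg _) h1 2).trans ?_
  refine (Finset.sum_mul_sq_le_sq_mul_sq _ _ _).trans (le_of_eq ?_)
  simp only [mul_pow, Real.sq_sqrt (hw _)]

/-- A bounded set `K` of vectors that contains one nonzero multiple of every unit vector carries a
finitely supported probability measure whose second moment form dominates, up to the factor `2 n`,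
all the forms `x ↦ |u ⬝ᵥ x| ^ 2` with `u ∈ K`. Exact maximization of the determinant over a compact
`K` would give the factor `n`; the factor `2 n` is what makes a near maximum sufficient. -/
theorem exists_weights_norm_dotProduct_sq_le {𝕜 : Type*} [RCLike 𝕜] {n : ℕ} (hn : 0 < n)
    {K : Set (Fin n → 𝕜)} {C : ℝ} (hC : ∀ v ∈ K, ∀ i, ‖v i‖ ≤ C)
    {r : 𝕜} (hr : r ≠ 0) (hK : ∀ i, Pi.single i r ∈ K) :
    ∃ (ι : Type) (_ : Fintype ι) (w : ι → ℝ) (v : ι → Fin n → 𝕜),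
      (∀ j, 0 ≤ w j) ∧ ∑ j, w j = 1 ∧ (∀ j, v j ∈ K) ∧
        ∀ u ∈ K, ∀ x, ‖u ⬝ᵥ x‖ ^ 2 ≤ 2 * n * ∑ j, w j * ‖v j ⬝ᵥ x‖ ^ 2 := by
  set P : Set (Matrix (Fin n) (Fin n) 𝕜) :=
    convexHull ℝ ((fun v => Matrix.vecMulVec (star v) v) '' K)
  have hn0 : (n : ℝ) ≠ 0 := by positivity
  have hC0 : 0 ≤ C := (norm_nonneg _).trans (hC _ (hK ⟨0, hn⟩) ⟨0, hn⟩)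
  have hbdd : ∀ G ∈ P, ‖G.det‖ ≤ n.factorial • (C * C) ^ n := by
    intro G hG
    have hent : ∀ i j, ‖G i j‖ ≤ C * C := by
      intro i j
      have hsub : P ⊆ {A | ‖A i j‖ ≤ C * C} := by
        refine convexHull_min ?_ ?_
        · rintro _ ⟨v, hv, rfl⟩
          simp only [Set.mem_ofPred_eq, Matrix.vecMulVec_apply, Pi.star_apply, norm_mul, norm_star]
          exact mul_le_mul (hC v hv i) (hC v hv j) (norm_nonneg _) hC0
        · intro A hA B hB a b ha hb hab
          simp only [Set.mem_ofPred_eq] at hA hB ⊢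
          calc ‖(a • A + b • B) i j‖ ≤ ‖a • A i j‖ + ‖b • B i j‖ := norm_add_le _ _
            _ = a * ‖A i j‖ + b * ‖B i j‖ := by
              rw [norm_smul, norm_smul, Real.norm_of_nonneg ha, Real.norm_of_nonneg hb]
            _ ≤ a * (C * C) + b * (C * C) := by gcongr
            _ = C * C := by rw [← add_mul, hab, one_mul]
      exact hsub hG
    have h := Matrix.det_le (abv := NormedField.toAbsoluteValue 𝕜) (A := G) hent
    rwa [Fintype.card_fin] at h
  set D : Set ℝ := (fun G : Matrix (Fin n) (Fin n) 𝕜 => ‖G.det‖) '' P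
  have hDbdd : BddAbove D := ⟨_, by rintro _ ⟨G, hG, rfl⟩; exact hbdd G hG⟩
  have hpos : 0 < sSup D := by
    -- Equal masses at the multiples of the unit vectors give a nonzero scalar matrix.
    set G₀ : Matrix (Fin n) (Fin n) 𝕜 :=
      ∑ i, (n : ℝ)⁻¹ • Matrix.vecMulVec (star (Pi.single i r)) (Pi.single i r) with hG₀
    have hmem : G₀ ∈ P :=
      mem_convexHull_of_exists_fintype (fun _ => (n : ℝ)⁻¹) _ (fun _ => by positivity)
        (by simp [hn0]) (fun i => ⟨_, hK i, rfl⟩) rfl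
    have hdiag : G₀ = Matrix.diagonal fun _ => (n : 𝕜)⁻¹ * (star r * r) := by
      ext i j
      rw [hG₀, Matrix.sum_apply, Finset.sum_eq_single i]
      · by_cases hij : i = j
        · subst hij
          simp [Matrix.vecMulVec_apply, RCLike.real_smul_eq_coe_mul]
        · simp [Matrix.vecMulVec_apply, hij, Ne.symm hij]
      · intro k _ hk
        simp [Matrix.vecMulVec_apply, Pi.single_apply, hk.symm]
      · simp
    refine lt_of_lt_of_le (norm_pos_iff.2 ?_) (le_csSup hDbdd ⟨G₀, hmem, rfl⟩)
    rw [hdiag, Matrix.det_diagonal]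
    refine Finset.prod_ne_zero_iff.2 fun _ _ => ?_
    have : (n : 𝕜) ≠ 0 := by exact_mod_cast hn.ne'
    simp [this, hr]
  have hδ : (1 : ℝ) < 1 + 1 / (2 * n) := by
    have : (0 : ℝ) < 1 / (2 * n) := by positivity
    linarith
  have hne : D.Nonempty := by
    rw [Set.nonempty_iff_ne_empty]
    intro h
    simp [h] at hpos
  -- `G` maximizes the determinant up to the factor `1 + 1 / (2 n)`, the least growth
  -- in `one_add_le_of_two_mul_lt`; so neither `K` nor the convex hull has to be compact.
  obtain ⟨_, ⟨G, hGP, rfl⟩, hGlt⟩ := exists_lt_of_lt_csSup hne (div_lt_self hpos hδ)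
  have hG0 : 0 < ‖G.det‖ := lt_trans (by positivity) hGlt
  rw [div_lt_iff₀ (by positivity)] at hGlt
  have hGdet : G.det ≠ 0 := norm_pos_iff.1 hG0
  obtain ⟨ι, _, w, z, hw, hw1, hz, hG⟩ := mem_convexHull_iff_exists_fintype.1 hGP
  choose v hvK hvz using hz
  simp only at hvz
  refine ⟨ι, inferInstance, w, v, hw, hw1, hvK, fun u hu x => ?_⟩
  have hform : ∀ a b : Fin n → 𝕜, star a ⬝ᵥ G.mulVec b =
      ∑ j, (w j : 𝕜) * (star (v j ⬝ᵥ a) * (v j ⬝ᵥ b)) := by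
    intro a b
    rw [← star_dotProduct_sum_vecMulVec_mulVec, ← hG]
    simp only [hvz]
  -- `y` represents the functional `u` with respect to the form `G`.
  set y : Fin n → 𝕜 := G⁻¹.mulVec (star u) with hy
  have hGy : G.mulVec y = star u := by
    rw [hy, Matrix.mulVec_mulVec, Matrix.mul_nonsing_inv _ (isUnit_iff_ne_zero.2 hGdet),
      Matrix.one_mulVec]
  have hstar : ∀ a : Fin n → 𝕜, star (u ⬝ᵥ a) =
      ∑ j, (w j : 𝕜) * (star (v j ⬝ᵥ a) * (v j ⬝ᵥ y)) := by
    intro a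
    rw [← hform, hGy, ← Matrix.star_dotProduct_star]
  have hq : RCLike.re (u ⬝ᵥ y) = ∑ j, w j * ‖v j ⬝ᵥ y‖ ^ 2 := by
    have h := congrArg RCLike.re (hstar y)
    rw [RCLike.star_def, RCLike.conj_re] at h
    rw [h, map_sum]
    refine Finset.sum_congr rfl fun j _ => ?_
    rw [RCLike.conj_mul, ← RCLike.ofReal_pow, ← RCLike.ofReal_mul,
      RCLike.ofReal_re]
  have hqle : RCLike.re (u ⬝ᵥ y) ≤ 2 * n := by
    by_contra! hlt
    set t : ℝ := 1 / (2 * (n : ℝ)) with ht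
    have hn1 : (1 : ℝ) ≤ n := by exact_mod_cast hn
    have ht0 : 0 < t := by positivity
    have ht1 : t < 1 := by
      rw [ht, div_lt_one (by positivity)]
      linarith
    have hmem : ((1 - t : ℝ) : 𝕜) • G + (t : 𝕜) • Matrix.vecMulVec (star u) u ∈ P := by
      have h := convex_convexHull ℝ ((fun v => Matrix.vecMulVec (star v) v) '' K) hGP
        (subset_convexHull ℝ _ ⟨u, hu, rfl⟩) (sub_nonneg.2 ht1.le) ht0.le (by ring)
      convert h using 1
      ext i j
      simp [RCLike.real_smul_eq_coe_mul]
    have h1 := le_csSup hDbdd ⟨_, hmem, rfl⟩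
    simp only at h1
    rw [det_smul_add_smul_vecMulVec hGdet _ _ (by
        exact_mod_cast (sub_pos.2 ht1).ne'), ← hy, norm_mul, norm_mul, norm_pow,
      RCLike.norm_ofReal, abs_of_pos (sub_pos.2 ht1)] at h1
    have h2 : 1 + (1 - t)⁻¹ * t * RCLike.re (u ⬝ᵥ y) ≤
        ‖1 + ((1 - t : ℝ) : 𝕜)⁻¹ * (t : 𝕜) * (u ⬝ᵥ y)‖ := by
      refine le_trans (le_of_eq ?_) (RCLike.re_le_norm _)
      rw [← RCLike.ofReal_inv, ← RCLike.ofReal_mul, map_add, RCLike.re_ofReal_mul, RCLike.one_re]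
    have h3 := (one_add_le_of_two_mul_lt hn hlt).trans
      (mul_le_mul_of_nonneg_left h2 (pow_nonneg (sub_nonneg.2 ht1.le) n))
    exact absurd (hGlt.trans_le (mul_le_mul_of_nonneg_left h3 hG0.le)) (not_lt.2 h1)
  calc ‖u ⬝ᵥ x‖ ^ 2 = ‖star (u ⬝ᵥ x)‖ ^ 2 := by rw [norm_star]
    _ ≤ (∑ j, w j * ‖v j ⬝ᵥ x‖ ^ 2) * ∑ j, w j * ‖v j ⬝ᵥ y‖ ^ 2 := by
      rw [hstar]
      exact norm_sum_mul_star_mul_sq_le hw _ _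
    _ ≤ (∑ j, w j * ‖v j ⬝ᵥ x‖ ^ 2) * (2 * n) := by
      rw [← hq]
      exact mul_le_mul_of_nonneg_left hqle
        (Finset.sum_nonneg fun j _ => mul_nonneg (hw j) (sq_nonneg _))
    _ = _ := mul_comm _ _

/-! ### Nuclear operators and the trace -/

/-- The left inverse is the inverse of `T` on `T(E)`, preceded by the orthogonal projection onto
`T(E)`; hence it needs no larger norm than the inverse. -/
theorem exists_linearMap_leftInverse {𝕜 X H : Type*} [RCLike 𝕜] [NormedAddCommGroup X]
    [NormedSpace 𝕜 X] [NormedAddCommGroup H] [InnerProductSpace 𝕜 H] (T : X →L[𝕜] H)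
    (E : Submodule 𝕜 X) [FiniteDimensional 𝕜 E] {A : ℝ} (hA : ∀ x ∈ E, ‖x‖ ≤ A * ‖T x‖)
    (hA0 : 0 ≤ A) :
    ∃ R : H →ₗ[𝕜] E, (∀ x : E, R (T x) = x) ∧ ∀ h, ‖R h‖ ≤ A * ‖h‖ := by
  set S : E →ₗ[𝕜] H := T.toLinearMap ∘ₗ E.subtype
  have hSapp : ∀ x : E, S x = T x := fun _ => rfl
  have hinj : Function.Injective S := by
    refine (injective_iff_map_eq_zero S).2 fun x hx => ?_
    have h := hA x x.2
    rw [← hSapp, hx, norm_zero, mul_zero] at h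
    exact Subtype.ext (norm_le_zero_iff.1 h)
  set e := LinearEquiv.ofInjective S hinj
  have hTe : ∀ h, T (e.symm h) = (h : H) := fun h =>
    congrArg Subtype.val (e.apply_symm_apply h)
  refine ⟨e.symm.toLinearMap ∘ₗ (LinearMap.range S).orthogonalProjectionOnto.toLinearMap,
    fun x => ?_, fun h => ?_⟩
  · have h1 : (LinearMap.range S).orthogonalProjectionOnto (T x) = e x :=
      Submodule.orthogonalProjectionOnto_mem_subspace_eq_self (e x)
    simp only [LinearMap.comp_apply, ContinuousLinearMap.coe_coe, h1]
    exact e.symm_apply_apply x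
  · set p := (LinearMap.range S).orthogonalProjectionOnto h
    have h1 : ‖p‖ ≤ ‖h‖ := Submodule.norm_orthogonalProjectionOnto_apply_le _ _
    calc ‖e.symm p‖ ≤ A * ‖T (e.symm p)‖ := hA _ (e.symm p).2
      _ = A * ‖p‖ := by rw [hTe]; rfl
      _ ≤ A * ‖h‖ := by gcongr

/-- A nuclear operator `T` that is bounded below by `1 / A` on `E` bounds the dimension of `E`, since
`finrank E` is the trace of `id_E = R T`, with `R` a left inverse of `T` on `E`. -/
theorem finrank_le_of_hasSum {𝕜 X H : Type*} [RCLike 𝕜] [NormedAddCommGroup X]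
    [NormedSpace 𝕜 X] [NormedAddCommGroup H] [InnerProductSpace 𝕜 H] (T : X →L[𝕜] H)
    {c : ℕ → 𝕜} {f : ℕ → StrongDual 𝕜 X} {y : ℕ → H} {a b : ℝ} (hc : Summable fun n => ‖c n‖)
    (hf : ∀ n, ‖f n‖ ≤ a) (hy : ∀ n, ‖y n‖ ≤ b)
    (hT : ∀ x : X, HasSum (fun n => c n • f n x • y n) (T x))
    (E : Submodule 𝕜 X) [FiniteDimensional 𝕜 E] {A : ℝ} (hA : ∀ x ∈ E, ‖x‖ ≤ A * ‖T x‖)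
    (hA0 : 0 ≤ A) :
    (Module.finrank 𝕜 E : ℝ) ≤ A * (a * b * ∑' n, ‖c n‖) := by
  obtain ⟨R, hR, hRA⟩ := exists_linearMap_leftInverse T E hA hA0
  set R' : H →L[𝕜] E := R.mkContinuous A hRA with hR'
  set e := Module.finBasis 𝕜 E
  have ha0 : 0 ≤ a := (norm_nonneg _).trans (hf 0)
  have hb0 : 0 ≤ b := (norm_nonneg _).trans (hy 0)
  -- The diagonal entries of `R T` in the basis `e` are all `1`.
  have h1 : ∀ i, HasSum (fun n => c n * (f n (e i) * e.coord i (R (y n)))) (1 : 𝕜) := by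
    intro i
    have h2 := ((hT (e i)).mapL R').mapL (LinearMap.toContinuousLinearMap (e.coord i))
    have h3 : (LinearMap.toContinuousLinearMap (e.coord i)) (R' (T (e i))) = 1 := by
      simp [hR', hR]
    rw [h3] at h2
    refine h2.congr_fun fun n => ?_
    simp [hR']
  have h2 := hasSum_sum (s := Finset.univ) fun i _ => h1 i
  have h3 : ∀ n, ∑ i, c n * (f n (e i) * e.coord i (R (y n))) = c n * f n (R (y n)) := by
    intro n
    rw [← Finset.mul_sum]
    congr 1
    conv_rhs => rw [← e.sum_repr (R (y n)), Submodule.coe_sum, map_sum]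
    simp [mul_comm]
  simp only [h3, Finset.sum_const, Finset.card_univ, Fintype.card_fin, nsmul_eq_mul, mul_one] at h2
  have h4 : ∀ n, ‖c n * f n (R (y n))‖ ≤ ‖c n‖ * (A * (a * b)) := by
    intro n
    rw [norm_mul]
    gcongr
    calc ‖f n (R (y n))‖ ≤ ‖f n‖ * ‖R (y n)‖ := (f n).le_opNorm _
      _ ≤ a * (A * b) := by
        gcongr
        · exact hf n
        · exact (hRA _).trans (by gcongr; exact hy n)
      _ = A * (a * b) := by ring
  have h5 := tsum_of_norm_bounded (hc.hasSum.mul_right (A * (a * b))) h4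
  rw [h2.tsum_eq, RCLike.norm_natCast] at h5
  linarith

/-! ### Summing operators -/

/-- The weak `2`-norm of a weakly `2`-summable sequence is finite: `f ↦ (f (x n))` is bounded from the
dual to `ℓ₂` by the closed graph theorem. -/
theorem exists_bound_sum_sq {𝕜 X : Type*} [RCLike 𝕜] [NormedAddCommGroup X] [NormedSpace 𝕜 X]
    {x : ℕ → X} (hx : x ∈ weaklySummableSeq 𝕜 2 X) :
    ∃ C : ℝ, ∀ f : StrongDual 𝕜 X, ∀ s : Finset ℕ, ∑ n ∈ s, ‖f (x n)‖ ^ 2 ≤ C * ‖f‖ ^ 2 := by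
  have hmem : ∀ f : StrongDual 𝕜 X, Memℓp (fun n => f (x n)) 2 := fun f =>
    memℓp_gen (by simpa using hx f)
  let L : StrongDual 𝕜 X →ₗ[𝕜] lp (fun _ : ℕ => 𝕜) 2 :=
    { toFun := fun f => ⟨fun n => f (x n), hmem f⟩
      map_add' := fun f g => rfl
      map_smul' := fun c f => rfl }
  have hL : Continuous L := by
    refine L.continuous_of_seq_closed_graph fun u f g hu hg => ?_
    ext n
    have h1 : Filter.Tendsto (fun k => u k (x n)) Filter.atTop (nhds (f (x n))) :=
      ((ContinuousLinearMap.apply 𝕜 𝕜 (x n)).continuous.tendsto f).comp hu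
    have h2 : Filter.Tendsto (fun k => u k (x n)) Filter.atTop (nhds (g n)) :=
      ((lp.evalCLM 𝕜 (fun _ : ℕ => 𝕜) 2 n).continuous.tendsto g).comp hg
    exact tendsto_nhds_unique h2 h1
  let L' : StrongDual 𝕜 X →L[𝕜] lp (fun _ : ℕ => 𝕜) 2 := ⟨L, hL⟩
  refine ⟨‖L'‖ ^ 2, fun f s => ?_⟩
  have h1 := lp.sum_rpow_le_norm_rpow (p := 2) (by norm_num) (L' f) s
  simp only [ENNReal.toReal_ofNat, Real.rpow_two] at h1
  calc _ ≤ ‖L' f‖ ^ 2 := h1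
    _ ≤ (‖L'‖ * ‖f‖) ^ 2 := by gcongr; exact L'.le_opNorm f
    _ = _ := mul_pow _ _ _

/-- The operator is `x ↦ (√(w j) * f j x)`. -/
theorem exists_clm_hasSum_norm_sq {𝕜 X : Type*} [RCLike 𝕜] [NormedAddCommGroup X] [NormedSpace 𝕜 X]
    {w : ℕ → ℝ} (hw : ∀ j, 0 ≤ w j) (hws : Summable w) {f : ℕ → StrongDual 𝕜 X}
    (hf : ∀ j, ‖f j‖ ≤ 1) :
    ∃ T : X →L[𝕜] lp (fun _ : ℕ => 𝕜) 2, ∀ x, HasSum (fun j => w j * ‖f j x‖ ^ 2) (‖T x‖ ^ 2) := by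
  have hle : ∀ x j, w j * ‖f j x‖ ^ 2 ≤ w j * ‖x‖ ^ 2 := fun x j => by
    have := (f j).le_of_opNorm_le (hf j) x
    rw [one_mul] at this
    exact mul_le_mul_of_nonneg_left (pow_le_pow_left₀ (norm_nonneg _) this 2) (hw j)
  have hsum : ∀ x, Summable fun j => w j * ‖f j x‖ ^ 2 := fun x =>
    (hws.mul_right _).of_nonneg_of_le (fun j => mul_nonneg (hw j) (sq_nonneg _)) (hle x)
  have hentry : ∀ x j, ‖(Real.sqrt (w j) : 𝕜) * f j x‖ ^ 2 = w j * ‖f j x‖ ^ 2 := fun x j => by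
    rw [norm_mul, mul_pow, RCLike.norm_ofReal, sq_abs, Real.sq_sqrt (hw j)]
  have hmem : ∀ x, Memℓp (fun j => (Real.sqrt (w j) : 𝕜) * f j x) 2 := fun x =>
    memℓp_gen (by simpa only [ENNReal.toReal_ofNat, Real.rpow_two, hentry] using hsum x)
  let L : X →ₗ[𝕜] lp (fun _ : ℕ => 𝕜) 2 :=
    { toFun := fun x => ⟨fun j => (Real.sqrt (w j) : 𝕜) * f j x, hmem x⟩
      map_add' := fun x y => by
        ext j
        exact (congrArg _ (map_add (f j) x y)).trans (mul_add _ _ _)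
      map_smul' := fun c x => by
        ext j
        simp [mul_left_comm] }
  have hL : ∀ x, HasSum (fun j => w j * ‖f j x‖ ^ 2) (‖L x‖ ^ 2) := fun x => by
    have h := lp.hasSum_norm (p := 2) (by norm_num) (L x)
    simp only [ENNReal.toReal_ofNat, Real.rpow_two] at h
    refine h.congr_fun fun j => (hentry x j).symm
  refine ⟨L.mkContinuous (Real.sqrt (∑' j, w j)) fun x => ?_, hL⟩
  rw [← abs_of_nonneg (norm_nonneg (L x)), ← abs_of_nonneg (a := Real.sqrt _ * ‖x‖) (by positivity),
    ← sq_le_sq, mul_pow, Real.sq_sqrt (tsum_nonneg hw)]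
  exact hasSum_le (hle x) (hL x) (hws.hasSum.mul_right _)

theorem mem_summingOperators_of_hasSum {𝕜 X Y : Type*} [RCLike 𝕜] [NormedAddCommGroup X]
    [NormedSpace 𝕜 X] [NormedAddCommGroup Y] [NormedSpace 𝕜 Y] {T : X →L[𝕜] Y}
    {w : ℕ → ℝ} (hw : ∀ j, 0 ≤ w j) (hws : Summable w) {f : ℕ → StrongDual 𝕜 X}
    (hf : ∀ j, ‖f j‖ ≤ 1) (hT : ∀ x, HasSum (fun j => w j * ‖f j x‖ ^ 2) (‖T x‖ ^ 2)) :
    T ∈ summingOperators 𝕜 2 X Y := by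
  intro x hx
  obtain ⟨C, hC⟩ := exists_bound_sum_sq hx
  have hC0 : ∀ j, C * ‖f j‖ ^ 2 ≤ |C| := fun j => by
    have h := mul_le_mul_of_nonneg_left (pow_le_one₀ (n := 2) (norm_nonneg _) (hf j)) (abs_nonneg C)
    exact (mul_le_mul_of_nonneg_right (le_abs_self C) (sq_nonneg _)).trans (by simpa using h)
  change Summable fun n => ‖T (x n)‖ ^ (2 : ℝ)
  simp only [Real.rpow_two]
  refine summable_of_sum_le (c := (∑' j, w j) * |C|) (fun n => sq_nonneg _) fun s => ?_
  have h1 := hasSum_sum (s := s) fun n _ => hT (x n)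
  refine hasSum_le (fun j => ?_) h1 (hws.hasSum.mul_right |C|)
  rw [← Finset.mul_sum]
  exact mul_le_mul_of_nonneg_left ((hC (f j) s).trans (hC0 j)) (hw j)

/-! ### Operators on finite-dimensional spaces -/

theorem mem_summingOperators_of_finiteDimensional {𝕜 X Y : Type*} [RCLike 𝕜] [NormedAddCommGroup X]
    [NormedSpace 𝕜 X] [FiniteDimensional 𝕜 X] [NormedAddCommGroup Y] [NormedSpace 𝕜 Y]
    (T : X →L[𝕜] Y) : T ∈ summingOperators 𝕜 2 X Y := by
  intro x hx
  set e := Module.finBasis 𝕜 X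
  have h1 : Summable fun n => (Module.finrank 𝕜 X : ℝ) *
      ∑ i, ‖e.coord i (x n)‖ ^ 2 * ‖T (e i)‖ ^ 2 := by
    refine (summable_sum fun i _ => Summable.mul_right _ ?_).mul_left _
    simpa using hx (LinearMap.toContinuousLinearMap (e.coord i))
  change Summable fun n => ‖T (x n)‖ ^ (2 : ℝ)
  simp only [Real.rpow_two]
  refine h1.of_nonneg_of_le (fun n => sq_nonneg _) fun n => ?_
  have h2 : ‖T (x n)‖ ≤ ∑ i, ‖e.coord i (x n)‖ * ‖T (e i)‖ := by
    conv_lhs => rw [← e.sum_repr (x n), map_sum]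
    refine (norm_sum_le _ _).trans (Finset.sum_le_sum fun i _ => ?_)
    rw [map_smul, norm_smul]
    rfl
  refine (pow_le_pow_left₀ (norm_nonneg _) h2 2).trans ?_
  simpa [mul_pow] using sq_sum_le_card_mul_sum_sq (s := Finset.univ)
    (f := fun i => ‖e.coord i (x n)‖ * ‖T (e i)‖)

theorem mem_nuclearOperators_of_finiteDimensional {𝕜 X Y : Type*} [RCLike 𝕜] [NormedAddCommGroup X]
    [NormedSpace 𝕜 X] [FiniteDimensional 𝕜 X] [NormedAddCommGroup Y] [NormedSpace 𝕜 Y]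
    (T : X →L[𝕜] Y) : T ∈ nuclearOperators 𝕜 X Y := by
  set e := Module.finBasis 𝕜 X
  set d := Module.finrank 𝕜 X
  let φ : Fin d → StrongDual 𝕜 X := fun i => LinearMap.toContinuousLinearMap (e.coord i)
  let c : ℕ → 𝕜 := fun n => if n < d then 1 else 0
  let f : ℕ → StrongDual 𝕜 X := fun n => if h : n < d then φ ⟨n, h⟩ else 0
  let y : ℕ → Y := fun n => if h : n < d then T (e ⟨n, h⟩) else 0
  have hsupp : ∀ n ∉ Finset.range d, c n = 0 := fun n hn => if_neg (by simpa using hn)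
  refine ⟨c, f, y, ?_, ⟨∑ i, ‖φ i‖, fun n => ?_⟩, ⟨∑ i, ‖T (e i)‖, fun n => ?_⟩, fun x => ?_⟩
  · exact summable_of_ne_finset_zero (s := Finset.range d) fun n hn => by simp [hsupp n hn]
  · by_cases h : n < d
    · simp only [f, h, dif_pos]
      exact Finset.single_le_sum (f := fun i => ‖φ i‖) (fun _ _ => norm_nonneg _)
        (Finset.mem_univ _)
    · simp only [f, h, dite_false, norm_zero]
      positivity
  · by_cases h : n < d
    · simp only [y, h, dif_pos]
      exact Finset.single_le_sum (f := fun i => ‖T (e i)‖) (fun _ _ => norm_nonneg _)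
        (Finset.mem_univ _)
    · simp only [y, h, dite_false, norm_zero]
      positivity
  · have h1 : T x = ∑ n ∈ Finset.range d, c n • f n x • y n := by
      conv_lhs => rw [← e.sum_repr x, map_sum]
      rw [Finset.sum_range]
      refine Finset.sum_congr rfl fun i _ => ?_
      simp [c, f, y, φ, i.2]
    rw [h1]
    exact hasSum_sum_of_ne_finset_zero fun n hn => by simp [hsupp n hn]

/-! ### A summing operator bounded below on large subspaces -/

/-- The nearly optimal design for the unit ball of the dual of `E`, with the functionals extended to
`X` by Hahn–Banach. The finitely many weights are padded by zeros to a sequence. -/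
theorem exists_weights_norm_sq_le {𝕜 X : Type*} [RCLike 𝕜] [NormedAddCommGroup X]
    [NormedSpace 𝕜 X] (E : Submodule 𝕜 X) [FiniteDimensional 𝕜 E]
    (hE : 0 < Module.finrank 𝕜 E) :
    ∃ (w : ℕ → ℝ) (f : ℕ → StrongDual 𝕜 X), (∀ j, 0 ≤ w j) ∧ HasSum w 1 ∧ (∀ j, ‖f j‖ ≤ 1) ∧
      ∀ x ∈ E, ‖x‖ ^ 2 ≤ 2 * Module.finrank 𝕜 E * ∑' j, w j * ‖f j x‖ ^ 2 := by
  set e := Module.finBasis 𝕜 E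
  let φ : Fin (Module.finrank 𝕜 E) → StrongDual 𝕜 E :=
    fun i => LinearMap.toContinuousLinearMap (e.coord i)
  -- The functionals `s⁻¹ • φ i` lie in the unit ball; they provide the multiples of the unit vectors.
  set s : ℝ := 1 + ∑ i, ‖φ i‖
  have hs0 : 0 < s := by positivity
  have hφ : ∀ i, ‖φ i‖ ≤ s := fun i => by
    have := Finset.single_le_sum (f := fun i => ‖φ i‖) (fun _ _ => norm_nonneg _)
      (Finset.mem_univ i)
    linarith
  obtain ⟨ι, _, w, v, hw, hw1, hv, hmain⟩ := exists_weights_norm_dotProduct_sq_le hE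
    (K := {v | ∃ ψ : StrongDual 𝕜 E, ‖ψ‖ ≤ 1 ∧ v = fun i => ψ (e i)})
    (C := ∑ i, ‖e i‖) (r := ((s⁻¹ : ℝ) : 𝕜))
    (by
      rintro _ ⟨ψ, hψ, rfl⟩ i
      calc ‖ψ (e i)‖ ≤ 1 * ‖e i‖ := ψ.le_of_opNorm_le hψ _
        _ = ‖e i‖ := one_mul _
        _ ≤ _ := Finset.single_le_sum (f := fun i => ‖e i‖) (fun _ _ => norm_nonneg _)
          (Finset.mem_univ i))
    (by exact_mod_cast (inv_pos.2 hs0).ne')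
    (fun i => ⟨((s⁻¹ : ℝ) : 𝕜) • φ i, by
      rw [norm_smul, RCLike.norm_ofReal, abs_of_pos (inv_pos.2 hs0), inv_mul_le_one₀ hs0]
      exact hφ i, by
      ext j
      simp [φ, Pi.single_apply, Finsupp.single_apply, eq_comm]⟩)
  choose ψ hψ hvψ using hv
  choose g hgext hgnorm using fun j => exists_extension_norm_eq E (ψ j)
  let N : ι → ℕ := fun j => Fintype.equivFin ι j
  have hN : Function.Injective N := Fin.val_injective.comp (Fintype.equivFin ι).injective
  have hz : ∀ m ∉ Set.range N, Function.extend N w 0 m = 0 := fun m hm =>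
    Function.extend_apply' _ _ _ hm
  refine ⟨Function.extend N w 0, Function.extend N g 0, fun m => ?_, ?_, fun m => ?_,
    fun x hx => ?_⟩
  · by_cases h : ∃ j, N j = m
    · obtain ⟨j, rfl⟩ := h
      rw [hN.extend_apply]
      exact hw j
    · rw [hz m h]
  · rw [← hN.hasSum_iff hz, Function.extend_comp hN, ← hw1]
    exact hasSum_fintype w
  · by_cases h : ∃ j, N j = m
    · obtain ⟨j, rfl⟩ := h
      rw [hN.extend_apply, hgnorm]
      exact hψ j
    · rw [Function.extend_apply' _ _ _ h]
      simp
  · have h1 : ∑' m, Function.extend N w 0 m * ‖Function.extend N g 0 m x‖ ^ 2 =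
        ∑ j, w j * ‖g j x‖ ^ 2 := by
      rw [← hN.tsum_eq, tsum_fintype]
      · simp only [hN.extend_apply]
      · intro m hm
        by_contra h
        exact hm (by simp [hz m h])
    rw [h1]
    obtain ⟨η, hη, hηx⟩ := exists_dual_vector'' 𝕜 (⟨x, hx⟩ : E)
    have hrep : ∀ θ : StrongDual 𝕜 E,
        (fun i => θ (e i)) ⬝ᵥ (fun i => e.repr ⟨x, hx⟩ i) = θ ⟨x, hx⟩ := fun θ => by
      conv_rhs => rw [← e.sum_repr ⟨x, hx⟩, map_sum]
      simp [dotProduct, mul_comm]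
    have h2 := hmain _ ⟨η, hη, rfl⟩ (fun i => e.repr ⟨x, hx⟩ i)
    simp only [hvψ, hrep, hηx, RCLike.norm_ofReal, abs_norm] at h2
    simp only [← hgext] at h2
    exact h2

theorem exists_submodule_finrank_eq {𝕜 X : Type*} [Field 𝕜] [AddCommGroup X] [Module 𝕜 X]
    (h : ¬ FiniteDimensional 𝕜 X) (n : ℕ) :
    ∃ E : Submodule 𝕜 X, FiniteDimensional 𝕜 E ∧ Module.finrank 𝕜 E = n := by
  have h1 : (n : Cardinal) ≤ Module.rank 𝕜 X :=
    (Cardinal.natCast_le_aleph0).trans (not_lt.1 fun h2 => h (Module.rank_lt_aleph0_iff.1 h2))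
  obtain ⟨v, hv⟩ := Module.le_rank_iff.1 h1
  refine ⟨Submodule.span 𝕜 (Set.range v), FiniteDimensional.span_of_finite 𝕜 (Set.finite_range v),
    ?_⟩
  rw [finrank_span_eq_card hv, Fintype.card_fin]

theorem summable_mul_fst_of_hasSum_one {a : ℕ → ℝ} (ha0 : ∀ k, 0 ≤ a k) (ha : Summable a)
    {w : ℕ → ℕ → ℝ} (hw : ∀ k j, 0 ≤ w k j) (hw1 : ∀ k, HasSum (w k) 1) :
    Summable fun p : ℕ × ℕ => a p.1 * w p.1 p.2 := by
  refine (summable_prod_of_nonneg fun p => mul_nonneg (ha0 p.1) (hw p.1 p.2)).2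
    ⟨fun k => (hw1 k).summable.mul_left (a k), ?_⟩
  simpa only [tsum_mul_left, (hw1 _).tsum_eq, mul_one] using ha

/-- The weights of the designs for the subspaces `E k` are scaled by `4 ^ (-k)` and arranged in one
sequence by the pairing function. -/
theorem exists_mem_summingOperators_norm_le {𝕜 X : Type*} [RCLike 𝕜] [NormedAddCommGroup X]
    [NormedSpace 𝕜 X] (E : ℕ → Submodule 𝕜 X) (hfin : ∀ k, FiniteDimensional 𝕜 (E k))
    (hE : ∀ k, Module.finrank 𝕜 (E k) = 16 ^ k) :
    ∃ T ∈ summingOperators 𝕜 2 X (lp (fun _ : ℕ => 𝕜) 2),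
      ∀ k, ∀ x ∈ E k, ‖x‖ ≤ 2 * 8 ^ k * ‖T x‖ := by
  choose w f hw hw1 hf hmain using fun k =>
    exists_weights_norm_sq_le (E k) (by rw [hE]; positivity)
  set W : ℕ → ℝ := fun m => (1 / 4) ^ m.unpair.1 * w m.unpair.1 m.unpair.2 with hW
  set F : ℕ → StrongDual 𝕜 X := fun m => f m.unpair.1 m.unpair.2 with hF
  have hW0 : ∀ m, 0 ≤ W m := fun m => mul_nonneg (by positivity) (hw _ _)
  have hWs : Summable W := by
    have h1 := summable_mul_fst_of_hasSum_one (a := fun k : ℕ => (1 / 4 : ℝ) ^ k)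
      (fun _ => by positivity) (summable_geometric_of_lt_one (by norm_num) (by norm_num)) hw hw1
    exact h1.comp_injective Nat.pairEquiv.symm.injective
  obtain ⟨T, hT⟩ := exists_clm_hasSum_norm_sq hW0 hWs (f := F) fun m => hf _ _
  refine ⟨T, mem_summingOperators_of_hasSum hW0 hWs (fun m => hf _ _) hT, fun k x hx => ?_⟩
  have h1 : (1 / 4 : ℝ) ^ k * ∑' j, w k j * ‖f k j x‖ ^ 2 ≤ ‖T x‖ ^ 2 := by
    have hinj : Function.Injective fun j => Nat.pair k j := fun i j hij =>
      (Nat.pair_eq_pair.1 hij).2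
    have h2 := tsum_comp_le_tsum_of_inj (hT x).summable
      (fun m => mul_nonneg (hW0 m) (sq_nonneg _)) hinj
    rw [(hT x).tsum_eq] at h2
    refine le_trans (le_of_eq ?_) h2
    rw [← tsum_mul_left]
    simp [hW, hF, mul_assoc, Function.comp_def]
  have h3 := hmain k x hx
  rw [hE] at h3
  refine le_of_sq_le_sq ?_ (by positivity)
  have h16 : (16 : ℝ) ^ k = 64 ^ k * (1 / 4) ^ k := by rw [← mul_pow]; norm_num
  have h64 : ((8 : ℝ) ^ k) ^ 2 = 64 ^ k := by rw [← pow_mul, mul_comm, pow_mul]; norm_num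
  calc ‖x‖ ^ 2 ≤ 2 * (16 : ℝ) ^ k * ∑' j, w k j * ‖f k j x‖ ^ 2 := by exact_mod_cast h3
    _ = 2 * 64 ^ k * ((1 / 4 : ℝ) ^ k * ∑' j, w k j * ‖f k j x‖ ^ 2) := by rw [h16]; ring
    _ ≤ 2 * 64 ^ k * ‖T x‖ ^ 2 := by gcongr
    _ ≤ 4 * 64 ^ k * ‖T x‖ ^ 2 := by gcongr; norm_num
    _ = (2 * 8 ^ k * ‖T x‖) ^ 2 := by rw [mul_pow, mul_pow, h64]; norm_num

theorem theorem3p4 {𝕜 : Type*} [RCLike 𝕜] {X : Type*} [NormedAddCommGroup X] [NormedSpace 𝕜 X]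
    [CompleteSpace X] :
    summingOperators 𝕜 2 X (lp (fun _ : ℕ => 𝕜) 2) = nuclearOperators 𝕜 X (lp (fun _ : ℕ => 𝕜) 2) ↔
      FiniteDimensional 𝕜 X := by
  refine ⟨fun h => ?_, fun _ => Set.ext fun T =>
    ⟨fun _ => mem_nuclearOperators_of_finiteDimensional T,
      fun _ => mem_summingOperators_of_finiteDimensional T⟩⟩
  by_contra hX
  choose E hfin hE using fun k : ℕ => exists_submodule_finrank_eq hX (16 ^ k)
  obtain ⟨T, hT, hTE⟩ := exists_mem_summingOperators_norm_le E hfin hE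
  rw [h] at hT
  obtain ⟨c, f, y, hc, ⟨a, ha⟩, ⟨b, hb⟩, hsum⟩ := hT
  set M : ℝ := a * b * ∑' n, ‖c n‖ with hM
  obtain ⟨k, hk⟩ := pow_unbounded_of_one_lt (2 * M) (by norm_num : (1 : ℝ) < 2)
  have h1 := finrank_le_of_hasSum T hc ha hb hsum (E k) (hTE k) (by positivity)
  rw [hE, ← hM] at h1
  have h2 : (8 : ℝ) ^ k * 2 ^ k ≤ 8 ^ k * (2 * M) := by
    rw [← mul_pow]
    norm_num at h1 ⊢
    linarith
  exact absurd (le_of_mul_le_mul_left h2 (by positivity)) (not_le.2 hk)
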